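/- Let $(X,\mathcal A,\mu)$ be a finite nonatomic measure space (every $A\in\mathcal A$ with $\mu(A)>0$ contains some $B\in\mathcal A$ with $0<\mu(B)<\mu(A)$), let $m\in\mathbb N$, and let $U\subset\mathbb R^m$ be compact and convex, with set of extreme points $\operatorname{ext}U$. Let $$\mathcal U:=\{u\in L^1(X)^m:\ u(x)\in U\ \text{for a.e. } x\in X\},$$ and let $u^*\in\mathcal U$. The following statements are equivalent. 1. $u^*$ is bang-bang, that is, $u^*(x)\in\operatorname{ext}U$ for a.e. $x\in X$. 2. For every sequence $\{u_n\}_{n\in\mathbb N}\subset\mathcal U$, if $u_n\rightharpoonup u^*$ weakly in $L^1(X)^m$, then $|u_n-u^*|_{L^1(X)^m}\to 0$. -/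

import Mathlib

open MeasureTheory Filter Topology

namespace BangBang

/-- A measure is nonatomic if every measurable set of positive measure contains a measurable
subset of strictly smaller positive measure. (This is stronger than singletons being null.) -/
def Nonatomic {X : Type*} [MeasurableSpace X] (μ : Measure X) : Prop :=
  ∀ A : Set X, MeasurableSet A → 0 < μ A →
    ∃ B : Set X, B ⊆ A ∧ MeasurableSet B ∧ 0 < μ B ∧ μ B < μ A

/-- The space `L¹(X)^m` of (classes of) integrable functions with values in Euclidean `ℝ^m`. -/
abbrev L1 {X : Type*} [MeasurableSpace X] (μ : Measure X) (m : ℕ) : Type _ :=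
  Lp (EuclideanSpace ℝ (Fin m)) 1 μ

/-- The feasible set: the `u ∈ L¹(X)^m` with `u(x) ∈ U` for almost every `x`. -/
def feasibleSet {X : Type*} [MeasurableSpace X] (μ : Measure X) {m : ℕ}
    (U : Set (EuclideanSpace ℝ (Fin m))) : Set (L1 μ m) :=
  {u | ∀ᵐ x ∂μ, u x ∈ U}

/-- `u` is bang-bang if `u(x)` is an extreme point of `U` for almost every `x`. -/
def IsBangBang {X : Type*} [MeasurableSpace X] {μ : Measure X} {m : ℕ}
    (U : Set (EuclideanSpace ℝ (Fin m))) (u : L1 μ m) : Prop :=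
  ∀ᵐ x ∂μ, u x ∈ U.extremePoints ℝ

/-- Weak convergence in `L¹(X)^m`: convergence in the weak topology of this Banach space, i.e.
against every continuous linear functional. -/
def WeaklyConverges {X : Type*} [MeasurableSpace X] {μ : Measure X} {m : ℕ}
    (u : ℕ → L1 μ m) (v : L1 μ m) : Prop :=
  Tendsto (fun n => toWeakSpace ℝ (L1 μ m) (u n)) atTop (𝓝 (toWeakSpace ℝ (L1 μ m) v))

end BangBang

/-! If u* is bang-bang: at an extreme point e, the distance to e is bounded on U by an affine
function with arbitrarily small value at e. Put e = u*(x), choose the slope measurably, cut it off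
where it is large, and integrate: ‖u_n - u*‖ is at most a small constant plus a continuous linear
functional of u_n - u*, which tends to 0 (`tendsto_norm_sub_of_isBangBang`).

Conversely, a point x of U that is not extreme has some v ≠ 0 with x ± v ∈ U. Select such v
measurably in x and multiply by orthogonal signs r_n, which exist because μ is nonatomic. Then u* +
r_n v is feasible and converges weakly to u* by a Bessel estimate, yet stays at constant distance
∫‖v‖ from u*. So v = 0 a.e.; selections aimed at each coordinate direction then exclude every
nonzero perturbation (`isBangBang_of_tendsto_norm_sub`). -/

namespace BangBang

/-! ### Affine majorants of the distance to an extreme point -/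

section Convex

/-- In finite dimension the convex hull of a compact set is compact. -/
theorem isCompact_convexHull {F : Type*} [NormedAddCommGroup F] [NormedSpace ℝ F]
    [FiniteDimensional ℝ F] {s : Set F} (hs : IsCompact s) : IsCompact (convexHull ℝ s) := by
  rcases s.eq_empty_or_nonempty with rfl | ⟨p, hp⟩
  · simp
  let N := Module.finrank ℝ F + 1
  have hK : IsCompact ((stdSimplex ℝ (Fin N)) ×ˢ (Set.univ.pi fun _ : Fin N => s)) :=
    (isCompact_stdSimplex ℝ (Fin N)).prod (isCompact_univ_pi fun _ => hs)
  have hf : Continuous fun q : (Fin N → ℝ) × (Fin N → F) => ∑ i, q.1 i • q.2 i := by fun_prop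
  convert hK.image hf using 1
  apply Set.Subset.antisymm
  · intro x hx
    -- Carathéodory: dim F + 1 points suffice. Unused slots get weight 0 and the dummy point `p`.
    obtain ⟨ι, _, z, w, hz, hind, hw, hw1, rfl⟩ := eq_pos_convex_span_of_mem_convexHull hx
    have hcard : Fintype.card ι ≤ Fintype.card (Fin N) := by
      simpa [N] using hind.card_le_finrank_succ.trans
        (Nat.succ_le_succ (Submodule.finrank_le _))
    obtain ⟨j⟩ := Function.Embedding.nonempty_of_card_le hcard
    have hoff : ∀ k ∉ Set.range j, Function.extend j w 0 k = 0 := fun k hk => by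
      rw [Function.extend_apply' _ _ _ (by simpa using hk)]; rfl
    refine ⟨(Function.extend j w 0, Function.extend j z fun _ => p), ⟨⟨fun k => ?_, ?_⟩, ?_⟩, ?_⟩
    · by_cases hk : k ∈ Set.range j
      · obtain ⟨i, rfl⟩ := hk
        simpa [j.injective.extend_apply] using (hw i).le
      · exact (hoff k hk).ge
    · rw [← hw1]
      refine (Fintype.sum_of_injective j j.injective _ _ hoff fun i => ?_).symm
      simp [j.injective.extend_apply]
    · intro k _
      by_cases hk : k ∈ Set.range j
      · obtain ⟨i, rfl⟩ := hk
        simpa [j.injective.extend_apply] using hz ⟨i, rfl⟩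
      · simpa [Function.extend_apply' _ _ _ (by simpa using hk)] using hp
    · refine (Fintype.sum_of_injective j j.injective _ _ (fun k hk => ?_) fun i => ?_).symm
      · simp [hoff k hk]
      · simp [j.injective.extend_apply]
  · rintro _ ⟨⟨w, z⟩, ⟨hw, hz⟩, rfl⟩
    exact (convex_convexHull ℝ s).sum_mem (fun i _ => hw.1 i) hw.2
      fun i _ => subset_convexHull ℝ s (hz i trivial)

variable {E : Type*} [NormedAddCommGroup E] [InnerProductSpace ℝ E] [FiniteDimensional ℝ E]

/-- At an extreme point `e` of a compact convex set, the concave envelope of the distance to `e`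
vanishes: the distance is dominated by affine functions with arbitrarily small value at `e`. -/
theorem exists_norm_sub_le_add_inner {U : Set E} (hUc : IsCompact U)
    (hU : Convex ℝ U) {e : E}
    (he : e ∈ U.extremePoints ℝ) {ε : ℝ} (hε : 0 < ε) :
    ∃ w : E, ∀ y ∈ U, ‖y - e‖ ≤ ε + inner ℝ w (y - e) := by
  let G : Set (E × ℝ) := (fun y => (y, ‖y - e‖)) '' U
  have hG : IsCompact G := hUc.image (by fun_prop)
  -- Extremality enters here: a proper convex combination equal to e has both endpoints equal to e.
  -- Hence the hull of the graph of the distance has no point of positive height above e.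
  have hT : Convex ℝ {q : E × ℝ | q.1 ∈ U ∧ (q.1 = e → q.2 ≤ 0)} := by
    rintro ⟨y, s⟩ ⟨hy, hys⟩ ⟨z, t⟩ ⟨hz, hzt⟩ a b ha hb hab
    refine ⟨hU hy hz ha hb hab, fun h => ?_⟩
    simp only [Prod.fst_add, Prod.smul_fst, Prod.snd_add, Prod.smul_snd, smul_eq_mul] at h hys hzt ⊢
    rcases ha.eq_or_lt with rfl | ha
    · obtain rfl : b = 1 := by linarith
      simpa using hzt (by simpa using h)
    rcases hb.eq_or_lt with rfl | hb
    · obtain rfl : a = 1 := by linarith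
      simpa using hys (by simpa using h)
    have hye := (mem_extremePoints.1 he).2 y hy z hz ⟨a, b, ha, hb, hab, h⟩
    nlinarith [hys hye.1, hzt hye.2]
  have hsub : convexHull ℝ G ⊆ {q : E × ℝ | q.1 ∈ U ∧ (q.1 = e → q.2 ≤ 0)} := by
    refine convexHull_min ?_ hT
    rintro _ ⟨y, hy, rfl⟩
    exact ⟨hy, fun h => by simp [show y = e from h]⟩
  have hnot : (e, ε) ∉ convexHull ℝ G := fun h => not_le.2 hε ((hsub h).2 rfl)
  obtain ⟨f, c, hfc, hcf⟩ := geometric_hahn_banach_closed_point (convex_convexHull ℝ G)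
    (isCompact_convexHull hG).isClosed hnot
  have hsplit : ∀ y s, f (y, s) = f (y, 0) + s * f (0, 1) := fun y s => by
    rw [← smul_eq_mul, ← map_smul, ← map_add]; simp
  have hlt : ∀ y ∈ U, f (y, 0) + ‖y - e‖ * f (0, 1) < f (e, 0) + ε * f (0, 1) := fun y hy => by
    rw [← hsplit, ← hsplit]
    exact (hfc _ (subset_convexHull ℝ G ⟨y, hy, rfl⟩)).trans hcf
  have hc : 0 < f (0, 1) := by
    have := hlt e he.1
    simp only [sub_self, norm_zero, zero_mul, add_zero, lt_add_iff_pos_right] at this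
    exact pos_of_mul_pos_right this hε.le
  let p : E →L[ℝ] ℝ := f.comp (ContinuousLinearMap.inl ℝ E ℝ)
  -- Solve the separating inequality for ‖y - e‖, dividing by the vertical coefficient f(0, 1) > 0.
  refine ⟨(InnerProductSpace.toDual ℝ E).symm (-(f (0, 1))⁻¹ • p), fun y hy => ?_⟩
  rw [InnerProductSpace.toDual_symm_apply]
  have h := hlt y hy
  have hp : ∀ z, p z = f (z, 0) := fun z => by simp [p]
  simp only [smul_apply, map_sub, hp, smul_eq_mul]
  rw [← mul_le_mul_iff_left₀ hc]
  have hcancel : (f (0, 1))⁻¹ * f (0, 1) = 1 := inv_mul_cancel₀ hc.ne'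
  have : (ε + (-(f (0, 1))⁻¹ * f (y, 0) - -(f (0, 1))⁻¹ * f (e, 0))) * f (0, 1)
      = ε * f (0, 1) - ((f (0, 1))⁻¹ * f (0, 1)) * (f (y, 0) - f (e, 0)) := by ring
  rw [this, hcancel]
  linarith

variable [MeasurableSpace E] [BorelSpace E]

/-- Since U is bounded, a slope that works for ε/2 may be moved to a nearby point of a countable
dense set at the cost of another ε/2. Taking the first dense slope that works is measurable, as each
condition is closed in e. -/
theorem exists_measurable_norm_sub_le_add_inner {U : Set E} (hUc : IsCompact U)
    (hU : Convex ℝ U) {ε : ℝ} (hε : 0 < ε) :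
    ∃ W : E → E, Measurable W ∧
      ∀ e ∈ U.extremePoints ℝ, ∀ y ∈ U, ‖y - e‖ ≤ ε + inner ℝ (W e) (y - e) := by
  classical
  obtain ⟨R, hR⟩ := hUc.isBounded.exists_norm_le
  let d := TopologicalSpace.denseSeq E
  let G : ℕ → Set E := fun n => {e | ∀ y ∈ U, ‖y - e‖ ≤ ε + inner ℝ (d n) (y - e)}
  have hG : ∀ n, MeasurableSet (G n) := fun n => by
    refine IsClosed.measurableSet ?_
    simp only [G, Set.ofPred_forall]
    exact isClosed_iInter fun y => isClosed_iInter fun _ =>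
      isClosed_le (by fun_prop) (by fun_prop)
  have hcov : ∀ e ∈ U.extremePoints ℝ, e ∈ ⋃ n, G n := by
    intro e he
    obtain ⟨w, hw⟩ := exists_norm_sub_le_add_inner hUc hU he (half_pos hε)
    have hR0 : 0 ≤ R := (norm_nonneg e).trans (hR e he.1)
    obtain ⟨n, hn⟩ := (TopologicalSpace.denseRange_denseSeq E).exists_dist_lt w
      (ε := ε / 2 / (2 * R + 1)) (by positivity)
    refine Set.mem_iUnion.2 ⟨n, fun y hy => (hw y hy).trans ?_⟩
    have h1 : ‖y - e‖ ≤ 2 * R + 1 := by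
      linarith [norm_sub_le y e, hR y hy, hR e he.1]
    have h2 : inner ℝ (w - d n) (y - e) ≤ ε / 2 := by
      refine (real_inner_le_norm _ _).trans ?_
      rw [dist_eq_norm, lt_div_iff₀ (by positivity)] at hn
      exact (mul_le_mul_of_nonneg_left h1 (norm_nonneg _)).trans hn.le
    rw [inner_sub_left] at h2
    linarith
  -- Adding the complement of the union makes `Nat.find` total.
  have hp : ∀ e, ∃ n, e ∈ G n ∪ (⋃ n, G n)ᶜ := fun e => by
    by_cases h : e ∈ ⋃ n, G n
    · obtain ⟨n, hn⟩ := Set.mem_iUnion.1 h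
      exact ⟨n, Or.inl hn⟩
    · exact ⟨0, Or.inr h⟩
  refine ⟨fun e => d (Nat.find (hp e)), (measurable_from_nat (f := d)).comp
    (measurable_find hp fun n => (hG n).union (MeasurableSet.iUnion hG).compl), fun e he => ?_⟩
  rcases Nat.find_spec (hp e) with h | h
  · exact h
  · exact absurd (hcov e he) h

end Convex


/-! ### Bang-bang implies strong convergence -/

section Forward

variable {X : Type*} [MeasurableSpace X] {μ : Measure X}

theorem weaklyConverges_iff {m : ℕ} {u : ℕ → L1 μ m} {v : L1 μ m} :
    WeaklyConverges u v ↔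
      ∀ φ : L1 μ m →L[ℝ] ℝ, Tendsto (fun n => φ (u n)) atTop (𝓝 (φ v)) := by
  refine WeakBilin.tendsto_iff_forall_eval_tendsto _ ?_
  intro x y h
  by_contra hxy
  obtain ⟨g, hg⟩ := SeparatingDual.exists_separating_of_ne (R := ℝ) (V := L1 μ m) hxy
  exact hg (DFunLike.congr_fun h g)

theorem tendsto_measure_norm_gt [IsFiniteMeasure μ] {F : Type*} [NormedAddCommGroup F]
    [MeasurableSpace F] [BorelSpace F] {g : X → F} (hg : Measurable g) :
    Tendsto (fun M : ℕ => μ.real {x | (M : ℝ) < ‖g x‖}) atTop (𝓝 0) := by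
  have h : Tendsto (fun M : ℕ => μ {x | (M : ℝ) < ‖g x‖}) atTop
      (𝓝 (μ (⋂ M : ℕ, {x | (M : ℝ) < ‖g x‖}))) := by
    refine tendsto_measure_iInter_atTop
      (fun M => (measurableSet_lt measurable_const hg.norm).nullMeasurableSet) ?_
      ⟨0, measure_ne_top _ _⟩
    intro M N hMN x hx
    exact (Nat.cast_le (α := ℝ).2 hMN).trans_lt (show (N : ℝ) < ‖g x‖ from hx)
  have he : (⋂ M : ℕ, {x | (M : ℝ) < ‖g x‖}) = ∅ := by
    refine Set.eq_empty_iff_forall_notMem.2 fun x hx => ?_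
    obtain ⟨M, hM⟩ := exists_nat_ge ‖g x‖
    exact not_lt.2 hM (Set.mem_iInter.1 hx M)
  rw [he, measure_empty] at h
  exact (ENNReal.tendsto_toReal ENNReal.zero_ne_top).comp h

variable {E : Type*} [NormedAddCommGroup E] [InnerProductSpace ℝ E]

/-- Pairing with a bounded function is a continuous functional on `L¹`. -/
theorem exists_clm_eq_integral_inner {g : X → E} (hg : AEStronglyMeasurable g μ) {M : ℝ}
    (hM : ∀ x, ‖g x‖ ≤ M) :
    ∃ φ : Lp E 1 μ →L[ℝ] ℝ, ∀ u : Lp E 1 μ,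
      Integrable (fun x => inner ℝ (g x) (u x)) μ ∧ φ u = ∫ x, inner ℝ (g x) (u x) ∂μ := by
  have hb : ∀ (u : Lp E 1 μ) x, ‖inner ℝ (g x) (u x)‖ ≤ M * ‖u x‖ := fun u x =>
    (norm_inner_le_norm _ _).trans (mul_le_mul_of_nonneg_right (hM x) (norm_nonneg _))
  have hint : ∀ u : Lp E 1 μ, Integrable (fun x => inner ℝ (g x) (u x)) μ := fun u =>
    ((L1.integrable_coeFn u).norm.const_mul M).mono' (hg.inner (Lp.aestronglyMeasurable u))
      (ae_of_all _ (hb u))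
  let ℓ : Lp E 1 μ →ₗ[ℝ] ℝ :=
    { toFun := fun u => ∫ x, inner ℝ (g x) (u x) ∂μ
      map_add' := fun u v => by
        rw [← integral_add (hint u) (hint v)]
        refine integral_congr_ae ?_
        filter_upwards [Lp.coeFn_add u v] with x hx
        rw [hx, Pi.add_apply, inner_add_right]
      map_smul' := fun c u => by
        rw [RingHom.id_apply, smul_eq_mul, ← integral_const_mul]
        refine integral_congr_ae ?_
        filter_upwards [Lp.coeFn_smul c u] with x hx
        rw [hx, Pi.smul_apply, inner_smul_right] }
  refine ⟨ℓ.mkContinuous M fun u => ?_, fun u => ⟨hint u, rfl⟩⟩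
  rw [L1.norm_eq_integral_norm, ← integral_const_mul]
  exact (norm_integral_le_integral_norm _).trans
    (integral_mono (hint u).norm ((L1.integrable_coeFn u).norm.const_mul M) (hb u))

theorem tendsto_norm_sub_of_isBangBang [IsFiniteMeasure μ] {m : ℕ}
    {U : Set (EuclideanSpace ℝ (Fin m))} (hUc : IsCompact U) (hU : Convex ℝ U) {v : L1 μ m}
    (hv : IsBangBang U v) {u : ℕ → L1 μ m} (hu : ∀ n, u n ∈ feasibleSet μ U)
    (huv : WeaklyConverges u v) :
    Tendsto (fun n => ‖u n - v‖) atTop (𝓝 0) := by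
  rw [weaklyConverges_iff] at huv
  obtain ⟨R, hR⟩ := hUc.isBounded.exists_norm_le
  refine tendsto_order.2 ⟨fun a ha => Eventually.of_forall fun n => ha.trans_le (norm_nonneg _),
    fun η hη => ?_⟩
  -- The error η is split in thirds: ε μ(X), the weakly null functional, and 2R μ(B), where B is the
  -- set on which the slope exceeds M.
  obtain ⟨W, hWm, hW⟩ := exists_measurable_norm_sub_le_add_inner hUc hU
    (ε := η / 3 / (μ.real Set.univ + 1)) (by positivity)
  set ε := η / 3 / (μ.real Set.univ + 1) with hε
  have hWv : Measurable fun x => W (v x) := hWm.comp (Lp.stronglyMeasurable v).measurable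
  have hεη : ε * μ.real Set.univ ≤ η / 3 := by
    have h0 : 0 ≤ μ.real Set.univ := measureReal_nonneg
    rw [hε, div_mul_eq_mul_div, div_le_iff₀ (by positivity)]
    nlinarith
  obtain ⟨M, hM⟩ := (((tendsto_measure_norm_gt (μ := μ) hWv).const_mul (2 * R)).eventually_lt_const
    (show 2 * R * 0 < η / 3 by linarith)).exists
  let B : Set X := {x | (M : ℝ) < ‖W (v x)‖}
  have hB : MeasurableSet B := measurableSet_lt measurable_const hWv.norm
  let g : X → EuclideanSpace ℝ (Fin m) := Bᶜ.indicator fun x => W (v x)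
  have hgM : ∀ x, ‖g x‖ ≤ M := fun x => by
    by_cases hx : x ∈ B
    · simp [g, hx]
    · simpa [g, hx] using not_lt.1 hx
  obtain ⟨φ, hφ⟩ := exists_clm_eq_integral_inner (μ := μ)
    (hWv.indicator hB.compl).aestronglyMeasurable hgM
  have hφ0 : Tendsto (fun n => φ (u n - v)) atTop (𝓝 0) := by
    simpa using (huv φ).sub_const (φ v)
  filter_upwards [hφ0.eventually_lt_const (show 0 < η / 3 by linarith)] with n hn
  have hpt : ∀ᵐ x ∂μ, ‖(u n - v : L1 μ m) x‖ ≤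
      (ε + inner ℝ (g x) ((u n - v : L1 μ m) x)) + B.indicator (fun _ => 2 * R) x := by
    filter_upwards [Lp.coeFn_sub (u n) v, hv, hu n] with x hx hvx hux
    rw [hx, Pi.sub_apply]
    by_cases hxB : x ∈ B
    · have h1 := norm_sub_le (u n x) (v x)
      have h2 := hR _ hux
      have h3 := hR _ hvx.1
      have h4 : 0 < ε := by positivity
      simp only [g, Set.indicator_of_mem hxB, Set.indicator_of_notMem (Set.notMem_compl_iff.2 hxB),
        inner_zero_left]
      linarith
    · simpa [g, hxB] using hW _ hvx _ hux
  have hi1 : Integrable (fun x => ε + inner ℝ (g x) ((u n - v : L1 μ m) x)) μ :=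
    (integrable_const ε).add (hφ _).1
  have hi2 : Integrable (B.indicator fun _ => 2 * R) μ := (integrable_const _).indicator hB
  rw [L1.norm_eq_integral_norm]
  refine (integral_mono_ae (L1.integrable_coeFn _).norm (hi1.add hi2) hpt).trans_lt ?_
  simp only [Pi.add_apply]
  rw [integral_add hi1 hi2, integral_add (integrable_const ε) (hφ _).1, ← (hφ _).2,
    integral_indicator_const _ hB, integral_const]
  simp only [smul_eq_mul]
  have hM' : 2 * R * μ.real B < η / 3 := hM
  linarith

end Forward


/-! ### Measurable selection of symmetric perturbations -/

section Perturbation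

variable {E : Type*} [NormedAddCommGroup E]

/-- The perturbations `v` with `x ± v ∈ U`. -/
def symmPerturbations (U : Set E) (x : E) : Set E := {v | x + v ∈ U ∧ x - v ∈ U}

theorem isCompact_symmPerturbations {U : Set E} (hUc : IsCompact U) (x : E) :
    IsCompact (symmPerturbations U x) := by
  refine ((hUc.image (f := fun y => y - x) (by fun_prop))).of_isClosed_subset ?_ fun v hv =>
    ⟨x + v, hv.1, by simp⟩
  exact (hUc.isClosed.preimage (f := fun v => x + v) (by fun_prop)).inter
    (hUc.isClosed.preimage (f := fun v => x - v) (by fun_prop))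

variable [InnerProductSpace ℝ E]

theorem convex_symmPerturbations {U : Set E} (hU : Convex ℝ U) (x : E) :
    Convex ℝ (symmPerturbations U x) := by
  intro v hv w hw a b ha hb hab
  have hx : x = a • x + b • x := by rw [← add_smul, hab, one_smul]
  constructor
  · convert hU hv.1 hw.1 ha hb hab using 1
    nth_rw 1 [hx]; module
  · convert hU hv.2 hw.2 ha hb hab using 1
    nth_rw 1 [hx]; module

theorem mem_extremePoints_of_symmPerturbations {U : Set E} (hU : Convex ℝ U) {x : E} (hx : x ∈ U)
    (h : ∀ v ∈ symmPerturbations U x, v = 0) : x ∈ U.extremePoints ℝ := by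
  refine mem_extremePoints.2 ⟨hx, fun a ha b hb ⟨s, t, hs, ht, hst, hab⟩ => ?_⟩
  -- Shifting weight min(s, t) between a and b keeps both coefficients nonnegative, so x ± min(s,
  -- t)(a - b) lie in U.
  have hr : 0 < min s t := lt_min hs ht
  have hv : min s t • (a - b) = 0 := by
    refine h _ ⟨?_, ?_⟩
    · convert hU ha hb (a := s + min s t) (b := t - min s t) (by positivity)
        (sub_nonneg.2 (min_le_right _ _)) (by linarith) using 1
      rw [← hab]; module
    · convert hU ha hb (a := s - min s t) (b := t + min s t)
        (sub_nonneg.2 (min_le_left _ _)) (by positivity) (by linarith) using 1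
      rw [← hab]; module
  obtain rfl : a = b := sub_eq_zero.1 ((smul_eq_zero.1 hv).resolve_left hr.ne')
  rw [← add_smul, hst, one_smul] at hab
  exact ⟨hab, hab⟩

variable [MeasurableSpace E] [BorelSpace E]

/-- Each sublevel set at finite t is the projection to x of a compact set of pairs (x, v), the pairs
being parametrized by a = x + v and b = x - v. -/
theorem measurable_infEDist_symmPerturbations_inter {U F : Set E} (hUc : IsCompact U)
    (hF : IsClosed F) (c : E) :
    Measurable fun x => Metric.infEDist c (symmPerturbations U x ∩ F) := by
  refine measurable_of_Iic fun t => ?_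
  rcases eq_or_ne t ⊤ with rfl | ht
  · simp
  let f : E × E → E × E := fun q => ((2⁻¹ : ℝ) • (q.1 + q.2), (2⁻¹ : ℝ) • (q.1 - q.2))
  have hf : Continuous f := by fun_prop
  have hC : IsCompact (f '' (U ×ˢ U) ∩ {q | q.2 ∈ F ∧ edist c q.2 ≤ t}) := by
    refine ((hUc.prod hUc).image hf).inter_right ?_
    exact (hF.preimage continuous_snd).inter (isClosed_le (continuous_const.edist continuous_snd) continuous_const)
  convert (hC.image continuous_fst).isClosed.measurableSet using 1
  ext x
  simp only [Set.mem_preimage, Set.mem_Iic]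
  constructor
  · intro hx
    have hne : (symmPerturbations U x ∩ F).Nonempty := by
      by_contra hne
      rw [Set.not_nonempty_iff_eq_empty.1 hne, Metric.infEDist_empty] at hx
      exact ht (top_le_iff.1 hx)
    obtain ⟨v, hv, hvd⟩ :=
      ((isCompact_symmPerturbations hUc x).inter_right hF).exists_infEDist_eq_edist hne c
    refine ⟨(x, v), ⟨⟨(x + v, x - v), hv.1, ?_⟩, hv.2, hvd ▸ hx⟩, rfl⟩
    ext <;> simp only [f] <;> module
  · rintro ⟨_, ⟨⟨⟨a, b⟩, ⟨ha, hb⟩, rfl⟩, hF', hd⟩, rfl⟩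
    refine le_trans (Metric.infEDist_le_edist_of_mem (Set.mem_inter ⟨?_, ?_⟩ hF')) hd
    · convert ha using 1; simp only [f]; module
    · convert hb using 1; simp only [f]; module

/-- The nearest point to `c` among the perturbations `v` with `x ± v ∈ U` is a measurable function
of `x`, and it vanishes only if no such perturbation has positive inner product with `c`. -/
theorem exists_measurable_mem_symmPerturbations {U : Set E} (hUc : IsCompact U) (hU : Convex ℝ U)
    (c : E) :
    ∃ V : E → E, Measurable V ∧ ∀ x ∈ U, V x ∈ symmPerturbations U x ∧
      (V x = 0 → ∀ v ∈ symmPerturbations U x, inner ℝ c v ≤ 0) := by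
  classical
  have h0 : ∀ x ∈ U, (0 : E) ∈ symmPerturbations U x := fun x hx => by
    simpa [symmPerturbations] using hx
  have hex : ∀ x, ∃ p, x ∈ U → p ∈ symmPerturbations U x ∧
      ∀ w ∈ symmPerturbations U x, inner ℝ (c - p) (w - p) ≤ 0 := by
    intro x
    by_cases hx : x ∈ U
    · obtain ⟨p, hp, hpm⟩ := exists_norm_eq_iInf_of_complete_convex ⟨0, h0 x hx⟩
        (isCompact_symmPerturbations hUc x).isComplete (convex_symmPerturbations hU x) c
      exact ⟨p, fun _ => ⟨hp, (norm_eq_iInf_iff_real_inner_le_zero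
        (convex_symmPerturbations hU x) hp).1 hpm⟩⟩
    · exact ⟨0, fun h => absurd h hx⟩
  choose p hp using hex
  have hmin : ∀ x ∈ U, ∀ w ∈ symmPerturbations U x,
      ‖c - p x‖ ^ 2 + ‖w - p x‖ ^ 2 ≤ ‖c - w‖ ^ 2 := by
    intro x hx w hw
    have h := (hp x hx).2 w hw
    have := norm_sub_sq_real (c - p x) (w - p x)
    rw [sub_sub_sub_cancel_right] at this
    linarith
  have hdist : ∀ x ∈ U, Metric.infEDist c (symmPerturbations U x ∩ Set.univ) = edist c (p x) := by
    intro x hx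
    rw [Set.inter_univ]
    refine le_antisymm (Metric.infEDist_le_edist_of_mem (hp x hx).1)
      (Metric.le_infEDist.2 fun w hw => ?_)
    rw [edist_dist, edist_dist, dist_eq_norm, dist_eq_norm]
    exact ENNReal.ofReal_le_ofReal ((sq_le_sq₀ (norm_nonneg _) (norm_nonneg _)).1 (by
      linarith [hmin x hx w hw, sq_nonneg ‖w - p x‖]))
  refine ⟨U.piecewise p 0, measurable_of_isClosed fun F hF => ?_, fun x hx => ?_⟩
  · have hset : U.piecewise p 0 ⁻¹' F =
        U.ite {x | Metric.infEDist c (symmPerturbations U x ∩ F) ≤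
          Metric.infEDist c (symmPerturbations U x ∩ Set.univ)} ((0 : E → E) ⁻¹' F) := by
      rw [Set.piecewise_preimage]
      ext x
      by_cases hx : x ∈ U
      · simp only [Set.ite, Set.mem_union, Set.mem_inter_iff, Set.mem_preimage, hx, and_true,
          Set.mem_sdiff, not_true, and_false, or_false, Set.mem_ofPred_eq]
        rw [hdist x hx]
        constructor
        · intro h
          exact Metric.infEDist_le_edist_of_mem ⟨(hp x hx).1, h⟩
        · intro h
          have hne : (symmPerturbations U x ∩ F).Nonempty := by
            by_contra hne
            rw [Set.not_nonempty_iff_eq_empty.1 hne, Metric.infEDist_empty] at h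
            exact edist_ne_top _ _ (top_le_iff.1 h)
          obtain ⟨w, hw, hwd⟩ :=
            ((isCompact_symmPerturbations hUc x).inter_right hF).exists_infEDist_eq_edist hne c
          rw [hwd, edist_dist, edist_dist, ENNReal.ofReal_le_ofReal_iff dist_nonneg, dist_eq_norm,
            dist_eq_norm] at h
          have h1 := hmin x hx w hw.1
          have h2 : ‖c - w‖ ^ 2 ≤ ‖c - p x‖ ^ 2 := pow_le_pow_left₀ (norm_nonneg _) h 2
          have h3 : ‖w - p x‖ = 0 := by
            have : ‖w - p x‖ ^ 2 ≤ 0 := by linarith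
            exact pow_eq_zero_iff two_ne_zero |>.1 (le_antisymm this (sq_nonneg _))
          rw [← sub_eq_zero.1 (norm_eq_zero.1 h3)]
          exact hw.2
      · simp [Set.ite, hx]
    rw [hset]
    exact hUc.measurableSet.ite
      (measurableSet_le (measurable_infEDist_symmPerturbations_inter hUc hF c)
        (measurable_infEDist_symmPerturbations_inter hUc isClosed_univ c))
      (measurable_zero hF.measurableSet)
  · rw [Set.piecewise_eq_of_mem _ _ _ hx]
    refine ⟨(hp x hx).1, fun h v hv => ?_⟩
    simpa [h] using (hp x hx).2 v hv

end Perturbation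


/-! ### Sierpiński's theorem and orthogonal signs -/

section Rademacher

variable {X : Type*} [MeasurableSpace X] {μ : Measure X}

/-- Split repeatedly and keep the smaller piece of positive measure. -/
theorem Nonatomic.exists_subset_two_pow_mul_le (hμ : Nonatomic μ) {A : Set X}
    (hA : MeasurableSet A) (hA0 : 0 < μ A) (n : ℕ) :
    ∃ B ⊆ A, MeasurableSet B ∧ 0 < μ B ∧ 2 ^ n * μ B ≤ μ A := by
  induction n with
  | zero => exact ⟨A, Set.Subset.rfl, hA, hA0, by simp⟩
  | succ n ih =>
    obtain ⟨B, hBA, hB, hB0, hBn⟩ := ih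
    obtain ⟨C, hCB, hC, hC0, hClt⟩ := hμ B hB hB0
    have hsum : μ C + μ (B \ C) = μ B := by
      rw [← measure_inter_add_sdiff B hC, Set.inter_eq_self_of_subset_right hCB]
    rcases le_total (μ C) (μ (B \ C)) with h | h
    · refine ⟨C, hCB.trans hBA, hC, hC0, le_trans ?_ hBn⟩
      rw [pow_succ, mul_assoc, ← hsum, two_mul]
      gcongr
    · refine ⟨B \ C, Set.sdiff_subset.trans hBA, hB.diff hC, ?_, le_trans ?_ hBn⟩
      · rw [pos_iff_ne_zero]
        intro h0
        rw [h0, add_zero] at hsum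
        exact hClt.ne hsum
      · rw [pow_succ, mul_assoc, ← hsum, two_mul]
        gcongr

/-- Sierpiński's theorem: a finite nonatomic measure takes all intermediate values. -/
theorem Nonatomic.exists_subset_measure_eq [IsFiniteMeasure μ] (hμ : Nonatomic μ) {A : Set X}
    (hA : MeasurableSet A) {t : ENNReal} (ht : t ≤ μ A) :
    ∃ B ⊆ A, MeasurableSet B ∧ μ B = t := by
  -- Greedy exhaustion: add a piece at least half as large as any admissible one. If the union fell
  -- short of t, a small set D would stay admissible throughout, so every increment would be at
  -- least μ(D)/2, contradicting finiteness.
  have hstep : ∀ B : {B : Set X // B ⊆ A ∧ MeasurableSet B ∧ μ B ≤ t},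
      ∃ C ⊆ A \ B.1, MeasurableSet C ∧ μ B.1 + μ C ≤ t ∧
        ∀ D ⊆ A \ B.1, MeasurableSet D → μ B.1 + μ D ≤ t → μ D ≤ 2 * μ C := by
    rintro ⟨B, hBA, hB, hBt⟩
    let S := ⨆ C : {C : Set X // C ⊆ A \ B ∧ MeasurableSet C ∧ μ B + μ C ≤ t}, μ C.1
    have hle : ∀ D ⊆ A \ B, MeasurableSet D → μ B + μ D ≤ t → μ D ≤ S := fun D h1 h2 h3 =>
      le_iSup (fun C : {C : Set X // C ⊆ A \ B ∧ MeasurableSet C ∧ μ B + μ C ≤ t} => μ C.1)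
        ⟨D, h1, h2, h3⟩
    have hS : S ≠ ⊤ := ((iSup_le fun C => measure_mono C.2.1).trans_lt
      (measure_lt_top μ (A \ B))).ne
    rcases eq_or_ne S 0 with h0 | h0
    · refine ⟨∅, Set.empty_subset _, MeasurableSet.empty, by simpa using hBt, fun D h1 h2 h3 => ?_⟩
      exact (hle D h1 h2 h3).trans (h0.le.trans zero_le)
    · obtain ⟨⟨C, hC1, hC2, hC3⟩, hC⟩ := lt_iSup_iff.1 (ENNReal.half_lt_self h0 hS)
      refine ⟨C, hC1, hC2, hC3, fun D h1 h2 h3 => (hle D h1 h2 h3).trans ?_⟩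
      calc S = 2 * (S / 2) := (ENNReal.mul_div_cancel two_ne_zero ENNReal.ofNat_ne_top).symm
        _ ≤ 2 * μ C := by gcongr
  choose C hCsub hCm hCt hCmax using hstep
  let step : {B : Set X // B ⊆ A ∧ MeasurableSet B ∧ μ B ≤ t} →
      {B : Set X // B ⊆ A ∧ MeasurableSet B ∧ μ B ≤ t} := fun B =>
    ⟨B.1 ∪ C B, Set.union_subset B.2.1 ((hCsub B).trans Set.sdiff_subset), B.2.2.1.union (hCm B),
      (measure_union_le _ _).trans (hCt B)⟩
  let B : ℕ → {B : Set X // B ⊆ A ∧ MeasurableSet B ∧ μ B ≤ t} := fun n =>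
    step^[n] ⟨∅, Set.empty_subset _, MeasurableSet.empty, by simp⟩
  have hBsucc : ∀ n, (B (n + 1)).1 = (B n).1 ∪ C (B n) := fun n => by
    simp only [B, Function.iterate_succ_apply', step]
  have hmono : Monotone fun n => (B n).1 := monotone_nat_of_le_succ fun n => by
    rw [hBsucc]; exact Set.subset_union_left
  have hUt : μ (⋃ n, (B n).1) ≤ t := by
    rw [hmono.measure_iUnion]; exact iSup_le fun n => (B n).2.2.2
  have hUm : MeasurableSet (⋃ n, (B n).1) := MeasurableSet.iUnion fun n => (B n).2.2.1
  refine ⟨⋃ n, (B n).1, Set.iUnion_subset fun n => (B n).2.1, hUm, ?_⟩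
  by_contra hne
  have hlt : μ (⋃ n, (B n).1) < t := lt_of_le_of_ne hUt hne
  have ht' : t ≠ ⊤ := (ht.trans_lt (measure_lt_top μ A)).ne
  have hdiff : 0 < μ (A \ ⋃ n, (B n).1) :=
    (tsub_pos_of_lt (hlt.trans_le ht)).trans_le le_measure_sdiff
  obtain ⟨k, hk⟩ := ENNReal.exists_nat_mul_gt (tsub_pos_of_lt hlt).ne' (measure_ne_top μ A)
  obtain ⟨D, hDsub, hDm, hD0, hDk⟩ :=
    hμ.exists_subset_two_pow_mul_le (hA.diff hUm) hdiff k
  have hDt : μ (⋃ n, (B n).1) + μ D ≤ t := by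
    have h1 : (2 : ENNReal) ^ k * μ D ≤ 2 ^ k * (t - μ (⋃ n, (B n).1)) := by
      refine hDk.trans ((measure_mono Set.sdiff_subset).trans (hk.le.trans ?_))
      gcongr
      exact_mod_cast Nat.lt_two_pow_self.le
    have h2 : μ D ≤ t - μ (⋃ n, (B n).1) :=
      (ENNReal.mul_le_mul_iff_right (by positivity) (by finiteness)).1 h1
    calc _ ≤ μ (⋃ n, (B n).1) + (t - μ (⋃ n, (B n).1)) := by gcongr
      _ = t := add_tsub_cancel_of_le hUt
  have hsubU : ∀ n, (B n).1 ⊆ ⋃ n, (B n).1 := fun n => Set.subset_iUnion (fun n => (B n).1) n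
  have hDC : ∀ n, μ D ≤ 2 * μ (C (B n)) := fun n =>
    hCmax (B n) D (hDsub.trans (Set.sdiff_subset_sdiff_right (hsubU n))) hDm
      (le_trans (by gcongr; exact hsubU n) hDt)
  have hgrow : ∀ n : ℕ, n * μ D ≤ 2 * μ (B n).1 := by
    intro n
    induction n with
    | zero => simp
    | succ n ih =>
      have hdisj : Disjoint (B n).1 (C (B n)) :=
        Set.disjoint_sdiff_right.mono_right (hCsub (B n))
      rw [hBsucc, measure_union hdisj (hCm _), mul_add, Nat.cast_succ, add_mul, one_mul]
      exact add_le_add ih (hDC n)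
  obtain ⟨n, hn⟩ := ENNReal.exists_nat_mul_gt hD0.ne' (b := 2 * t) (by finiteness)
  exact absurd ((hgrow n).trans (mul_le_mul_right (B n).2.2.2 2)) (not_le.2 hn)

/-- On each level set of a measurable `c : X → ℕ` a sign function with mean zero. -/
theorem Nonatomic.exists_sign_setIntegral_eq_zero [IsFiniteMeasure μ] (hμ : Nonatomic μ)
    {c : X → ℕ} (hc : Measurable c) :
    ∃ r : X → ℝ, Measurable r ∧ (∀ x, r x = 1 ∨ r x = -1) ∧
      ∀ j, ∫ x in c ⁻¹' {j}, r x ∂μ = 0 := by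
  classical
  have hcm : ∀ j, MeasurableSet (c ⁻¹' {j}) := fun j => hc (measurableSet_singleton j)
  choose H hHsub hHm hHμ using fun j =>
    hμ.exists_subset_measure_eq (hcm j) (ENNReal.half_le_self (a := μ (c ⁻¹' {j})))
  have hUm : MeasurableSet (⋃ j, H j) := MeasurableSet.iUnion hHm
  refine ⟨fun x => (⋃ j, H j).indicator (fun _ => 2) x - 1,
    (measurable_const.indicator hUm).sub_const 1, fun x => ?_, fun j => ?_⟩
  · by_cases hx : x ∈ ⋃ j, H j
    · left; simp only [Set.indicator_of_mem hx]; norm_num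
    · right; simp only [Set.indicator_of_notMem hx]; norm_num
  · have hinter : (⋃ i, H i) ∩ c ⁻¹' {j} = H j := by
      ext x
      simp only [Set.mem_inter_iff, Set.mem_iUnion]
      refine ⟨fun ⟨⟨i, hi⟩, hx⟩ => ?_, fun hx => ⟨⟨j, hx⟩, hHsub j hx⟩⟩
      have h1 : c x = i := hHsub i hi
      have h2 : c x = j := hx
      rwa [← h2, h1]
    rw [integral_sub ((integrable_const _).indicator hUm) (integrable_const _),
      integral_indicator_const _ hUm, integral_const, measureReal_restrict_apply hUm, hinter,
      measureReal_restrict_apply MeasurableSet.univ, Set.univ_inter]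
    simp [Measure.real, hHμ j]

/-- A finite nonatomic measure carries a sequence of orthogonal sign functions. -/
theorem Nonatomic.exists_orthogonal_signs [IsFiniteMeasure μ] (hμ : Nonatomic μ) :
    ∃ r : ℕ → X → ℝ, (∀ n, Measurable (r n)) ∧ (∀ n x, r n x = 1 ∨ r n x = -1) ∧
      ∀ k n, k ≠ n → ∫ x, r k x * r n x ∂μ = 0 := by
  classical
  choose s hsm hs hs0 using fun c : {c : X → ℕ // Measurable c} =>
    hμ.exists_sign_setIntegral_eq_zero c.2
  -- The code c_n records all earlier signs, so r_k with k < n is constant on each level set of c_n,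
  -- where r_n has mean zero.
  let step : {c : X → ℕ // Measurable c} → {c : X → ℕ // Measurable c} := fun c =>
    ⟨fun x => Nat.pair (c.1 x) (if s c x = 1 then 1 else 0),
      (Measurable.of_discrete (f := fun q : ℕ × ℕ => Nat.pair q.1 q.2)).comp (c.2.prodMk
        (Measurable.ite (hsm c (measurableSet_singleton 1)) measurable_const measurable_const))⟩
  let c : ℕ → {c : X → ℕ // Measurable c} := fun n => step^[n] ⟨fun _ => 0, measurable_const⟩
  have hcs : ∀ n x y, (c (n + 1)).1 x = (c (n + 1)).1 y →
      (c n).1 x = (c n).1 y ∧ s (c n) x = s (c n) y := by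
    intro n x y h
    simp only [c, Function.iterate_succ_apply', step] at h
    obtain ⟨h1, h2⟩ := Nat.pair_eq_pair.1 h
    refine ⟨h1, ?_⟩
    change (if s (c n) x = 1 then 1 else 0) = (if s (c n) y = 1 then 1 else 0) at h2
    rcases hs (c n) x with hx | hx <;> rcases hs (c n) y with hy | hy <;> rw [hx, hy] at h2 ⊢ <;>
      norm_num at h2
  have hconst : ∀ k d x y, (c (k + 1 + d)).1 x = (c (k + 1 + d)).1 y →
      s (c k) x = s (c k) y := by
    intro k d
    induction d with
    | zero => exact fun x y h => (hcs k x y h).2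
    | succ d ih => exact fun x y h => ih x y (hcs _ x y h).1
  have habs : ∀ n x, ‖s (c n) x‖ ≤ 1 := fun n x => by
    rcases hs (c n) x with h | h <;> simp [h]
  have hlt : ∀ k n, k < n → ∫ x, s (c k) x * s (c n) x ∂μ = 0 := by
    intro k n hkn
    obtain ⟨d, rfl⟩ := Nat.exists_eq_add_of_le (Nat.succ_le_of_lt hkn)
    have hint : Integrable (fun x => s (c k) x * s (c (k + 1 + d)) x) μ := by
      refine Integrable.of_bound ((hsm _).mul (hsm _)).aestronglyMeasurable 1 (ae_of_all _ fun x => ?_)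
      rw [norm_mul]
      exact mul_le_one₀ (habs _ x) (norm_nonneg _) (habs _ x)
    have hcm : ∀ j, MeasurableSet ((c (k + 1 + d)).1 ⁻¹' {j}) := fun j =>
      (c (k + 1 + d)).2 (measurableSet_singleton j)
    have huniv : (⋃ j, (c (k + 1 + d)).1 ⁻¹' {j}) = Set.univ := by
      ext x; simp
    have hsum := hasSum_integral_iUnion hcm
      (fun i j hij => Disjoint.preimage _ (Set.disjoint_singleton.2 hij)) hint.integrableOn
    rw [huniv, setIntegral_univ] at hsum
    refine hsum.unique ?_
    convert hasSum_zero using 1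
    funext j
    rcases ((c (k + 1 + d)).1 ⁻¹' {j}).eq_empty_or_nonempty with h | ⟨y, hy⟩
    · simp [h]
    · rw [setIntegral_congr_fun (g := fun x => s (c k) y * s (c (k + 1 + d)) x) (hcm j)
        fun x hx => ?_, integral_const_mul, hs0, mul_zero]
      have hxy : (c (k + 1 + d)).1 x = (c (k + 1 + d)).1 y := Eq.trans hx hy.symm
      simp only [hconst k d x y hxy]
  refine ⟨fun n => s (c n), fun n => hsm _, fun n => hs _, fun k n hkn => ?_⟩
  rcases hkn.lt_or_gt with h | h
  · exact hlt k n h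
  · simpa only [mul_comm] using hlt n k h

end Rademacher


/-! ### Weakly null modulations and the converse -/

section Converse

/-- A Bessel-type criterion for weak convergence to zero. -/
theorem tendsto_clm_zero_of_norm_sum_le {F : Type*} [NormedAddCommGroup F] [NormedSpace ℝ F]
    {z : ℕ → F} {C : ℝ}
    (hz : ∀ (s : Finset ℕ) (a : ℕ → ℝ), ‖∑ i ∈ s, a i • z i‖ ≤ C * (1 + ∑ i ∈ s, a i ^ 2))
    (φ : F →L[ℝ] ℝ) : Tendsto (fun n => φ (z n)) atTop (𝓝 0) := by
  have hC : 0 ≤ C := by simpa using hz ∅ 0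
  have hK : 0 ≤ ‖φ‖ * C := by positivity
  set K := ‖φ‖ * C with hKdef
  have hbound : ∀ s : Finset ℕ, ∑ i ∈ s, φ (z i) ^ 2 ≤ 2 * K * (2 * K + 1) := by
    intro s
    set S := ∑ i ∈ s, φ (z i) ^ 2 with hS
    have hS0 : 0 ≤ S := Finset.sum_nonneg fun i _ => sq_nonneg _
    -- Testing with a_i = t φ(z_i) gives tS ≤ K + K t² S; this t makes Kt ≤ 1/2, so the last term is
    -- absorbed.
    set t := (2 * K + 1)⁻¹ with ht
    have ht0 : 0 < t := by positivity
    have htK : t * (2 * K + 1) = 1 := inv_mul_cancel₀ (by positivity)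
    have h1 : t * S ≤ K * (1 + t ^ 2 * S) := by
      calc t * S = φ (∑ i ∈ s, (t * φ (z i)) • z i) := by
            rw [map_sum, hS, Finset.mul_sum]
            exact Finset.sum_congr rfl fun i _ => by rw [map_smul, smul_eq_mul]; ring
        _ ≤ ‖φ‖ * ‖∑ i ∈ s, (t * φ (z i)) • z i‖ :=
            (le_abs_self _).trans (φ.le_opNorm _)
        _ ≤ ‖φ‖ * (C * (1 + ∑ i ∈ s, (t * φ (z i)) ^ 2)) := by
            gcongr; exact hz s fun i => t * φ (z i)
        _ = K * (1 + t ^ 2 * S) := by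
            simp only [mul_pow, ← Finset.mul_sum]; rw [hKdef, mul_assoc]
    have h2 : t * S ≤ 2 * K := by
      have : K * t ≤ 1 / 2 := by nlinarith
      nlinarith [mul_le_mul_of_nonneg_right this (mul_nonneg ht0.le hS0)]
    calc S = (t * (2 * K + 1)) * S := by rw [htK, one_mul]
      _ = (t * S) * (2 * K + 1) := by ring
      _ ≤ 2 * K * (2 * K + 1) := by gcongr
  have hsum : Summable fun i => φ (z i) ^ 2 := summable_of_sum_le (fun i => sq_nonneg _) hbound
  have h := hsum.tendsto_atTop_zero.sqrt
  simp only [Real.sqrt_sq_eq_abs, Real.sqrt_zero] at h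
  exact (tendsto_zero_iff_abs_tendsto_zero _).2 h

variable {X : Type*} [MeasurableSpace X] {μ : Measure X} [IsFiniteMeasure μ]

theorem integral_sq_sum_orthogonal_signs {r : ℕ → X → ℝ} (hrm : ∀ n, Measurable (r n))
    (hr : ∀ n x, r n x = 1 ∨ r n x = -1)
    (horth : ∀ k n, k ≠ n → ∫ x, r k x * r n x ∂μ = 0) (s : Finset ℕ) (a : ℕ → ℝ) :
    Integrable (fun x => (∑ i ∈ s, a i * r i x) ^ 2) μ ∧
      ∫ x, (∑ i ∈ s, a i * r i x) ^ 2 ∂μ = (∑ i ∈ s, a i ^ 2) * μ.real Set.univ := by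
  have hint : ∀ k n, Integrable (fun x => (a k * r k x) * (a n * r n x)) μ := fun k n => by
    refine Integrable.of_bound (((hrm k).const_mul _).mul ((hrm n).const_mul _)).aestronglyMeasurable
      (|a k| * |a n|) (ae_of_all _ fun x => ?_)
    rcases hr k x with h | h <;> rcases hr n x with h' | h' <;> simp [h, h']
  have heq : (fun x => (∑ i ∈ s, a i * r i x) ^ 2) =
      fun x => ∑ i ∈ s, ∑ j ∈ s, (a i * r i x) * (a j * r j x) := by
    funext x; rw [sq, Finset.sum_mul_sum]
  rw [heq]
  refine ⟨integrable_finsetSum _ fun i _ => integrable_finsetSum _ fun j _ => hint i j, ?_⟩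
  rw [integral_finsetSum _ fun i _ => integrable_finsetSum _ fun j _ => hint i j, Finset.sum_mul]
  refine Finset.sum_congr rfl fun i hi => ?_
  rw [integral_finsetSum _ fun j _ => hint i j, Finset.sum_eq_single_of_mem i hi fun j _ hji => ?_]
  · have : (fun x => a i * r i x * (a i * r i x)) = fun _ => a i ^ 2 := by
      funext x; rcases hr i x with h | h <;> rw [h] <;> ring
    rw [this, integral_const, smul_eq_mul, mul_comm]
  · have : (fun x => a i * r i x * (a j * r j x)) = fun x => (a i * a j) * (r i x * r j x) := by
      funext x; ring
    rw [this, integral_const_mul, horth i j hji.symm, mul_zero]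

/-- Modulating a bounded function by orthogonal signs gives a weakly null sequence in `L¹`. -/
theorem exists_sign_modulation (hμ : Nonatomic μ) {m : ℕ} {v : X → EuclideanSpace ℝ (Fin m)}
    (hv : Measurable v) {M : ℝ} (hM : ∀ᵐ x ∂μ, ‖v x‖ ≤ M) :
    ∃ z : ℕ → L1 μ m, (∀ n, ∀ᵐ x ∂μ, z n x = v x ∨ z n x = -v x) ∧
      ∀ φ : L1 μ m →L[ℝ] ℝ, Tendsto (fun n => φ (z n)) atTop (𝓝 0) := by
  obtain ⟨r, hrm, hr, horth⟩ := hμ.exists_orthogonal_signs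
  have hmem : ∀ n, MemLp (fun x => r n x • v x) 1 μ := fun n => by
    refine MemLp.of_bound ((hrm n).smul hv).aestronglyMeasurable M ?_
    filter_upwards [hM] with x hx
    rcases hr n x with h | h <;> simpa [h] using hx
  have hcoe : ∀ᵐ x ∂μ, ∀ n, (hmem n).toLp _ x = r n x • v x :=
    ae_all_iff.2 fun n => (hmem n).coeFn_toLp
  refine ⟨fun n => (hmem n).toLp _, fun n => ?_, ?_⟩
  · filter_upwards [hcoe] with x hx
    rcases hr n x with h | h <;> simp [hx n, h]
  refine tendsto_clm_zero_of_norm_sum_le (C := |M| * (1 + μ.real Set.univ)) fun s a => ?_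
  obtain ⟨hint, hval⟩ := integral_sq_sum_orthogonal_signs (μ := μ) hrm hr horth s a
  have hsum : ∀ᵐ x ∂μ, (∑ i ∈ s, a i • (hmem i).toLp _ : L1 μ m) x =
      (∑ i ∈ s, a i * r i x) • v x := by
    have h1 := Lp.coeFn_finsetSum s fun i => a i • (hmem i).toLp _
    have h2 : ∀ᵐ x ∂μ, ∀ i, (a i • (hmem i).toLp _ : L1 μ m) x = a i • (hmem i).toLp _ x :=
      ae_all_iff.2 fun i => Lp.coeFn_smul _ _
    filter_upwards [h1, h2, hcoe] with x h1 h2 h3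
    rw [h1, Finset.sum_apply, Finset.sum_smul]
    refine Finset.sum_congr rfl fun i _ => ?_
    rw [h2 i, h3 i, smul_smul]
  have hpt : ∀ᵐ x ∂μ, ‖(∑ i ∈ s, a i • (hmem i).toLp _ : L1 μ m) x‖ ≤
      |M| * (1 + (∑ i ∈ s, a i * r i x) ^ 2) := by
    filter_upwards [hsum, hM] with x hx hMx
    rw [hx, norm_smul, mul_comm, Real.norm_eq_abs]
    refine mul_le_mul (hMx.trans (le_abs_self M)) ?_ (abs_nonneg _) (abs_nonneg _)
    -- |y| ≤ 1 + y² passes from the L¹ norm to the orthogonality identity in L².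
    nlinarith [sq_abs (∑ i ∈ s, a i * r i x), sq_nonneg (|∑ i ∈ s, a i * r i x| - 1)]
  rw [L1.norm_eq_integral_norm]
  refine (integral_mono_ae (L1.integrable_coeFn _).norm
    (((integrable_const (1 : ℝ)).add hint).const_mul |M|) hpt).trans ?_
  simp only [Pi.add_apply]
  rw [integral_const_mul, integral_add (integrable_const _) hint, hval, integral_const, mul_assoc]
  have h0 : 0 ≤ μ.real Set.univ := measureReal_nonneg
  have h1 : 0 ≤ ∑ i ∈ s, a i ^ 2 := Finset.sum_nonneg fun i _ => sq_nonneg _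
  refine mul_le_mul_of_nonneg_left ?_ (abs_nonneg M)
  simp only [smul_eq_mul, mul_one]
  nlinarith

theorem isBangBang_of_tendsto_norm_sub (hμ : Nonatomic μ) {m : ℕ}
    {U : Set (EuclideanSpace ℝ (Fin m))} (hUc : IsCompact U) (hU : Convex ℝ U) {v : L1 μ m}
    (hv : v ∈ feasibleSet μ U)
    (h : ∀ u : ℕ → L1 μ m, (∀ n, u n ∈ feasibleSet μ U) → WeaklyConverges u v →
      Tendsto (fun n => ‖u n - v‖) atTop (𝓝 0)) :
    IsBangBang U v := by
  obtain ⟨R, hR⟩ := hUc.isBounded.exists_norm_le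
  choose V hVm hV using fun i : Fin m =>
    exists_measurable_mem_symmPerturbations hUc hU (EuclideanSpace.basisFun (Fin m) ℝ i)
  have hzero : ∀ i, ∀ᵐ x ∂μ, V i (v x) = 0 := by
    intro i
    have hVv : Measurable fun x => V i (v x) :=
      (hVm i).comp (Lp.stronglyMeasurable v).measurable
    have hbd : ∀ᵐ x ∂μ, ‖V i (v x)‖ ≤ 2 * R := by
      filter_upwards [hv] with x hx
      have h1 := hR _ (hV i _ hx).1.1
      have h2 := hR _ hx
      have h3 := norm_sub_le (v x + V i (v x)) (v x)
      rw [add_sub_cancel_left] at h3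
      linarith
    obtain ⟨z, hz, hz0⟩ := exists_sign_modulation hμ hVv hbd
    have hlim := h (fun n => v + z n) (fun n => ?_) (weaklyConverges_iff.2 fun φ => ?_)
    · have hnorm : ∀ n, ‖v + z n - v‖ = ∫ x, ‖V i (v x)‖ ∂μ := fun n => by
        rw [add_sub_cancel_left, L1.norm_eq_integral_norm]
        refine integral_congr_ae ?_
        filter_upwards [hz n] with x hx
        rcases hx with hx | hx <;> simp [hx]
      simp only [hnorm] at hlim
      have hint0 : ∫ x, ‖V i (v x)‖ ∂μ = 0 := tendsto_const_nhds_iff.1 hlim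
      have hint : Integrable (fun x => ‖V i (v x)‖) μ :=
        (Integrable.of_bound hVv.aestronglyMeasurable _ hbd).norm
      rw [integral_eq_zero_iff_of_nonneg (fun x => norm_nonneg _) hint] at hint0
      filter_upwards [hint0] with x hx
      simpa using hx
    · filter_upwards [hv, hz n, Lp.coeFn_add v (z n)] with x hx hzx hadd
      rw [hadd, Pi.add_apply]
      rcases hzx with hzx | hzx
      · rw [hzx]; exact (hV i _ hx).1.1
      · rw [hzx, ← sub_eq_add_neg]; exact (hV i _ hx).1.2
    · simpa using (hz0 φ).const_add (φ v)
  filter_upwards [hv, ae_all_iff.2 hzero] with x hx hzx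
  refine mem_extremePoints_of_symmPerturbations hU hx fun d hd => ?_
  -- The perturbation set is symmetric, so the one-sided inequalities become equalities.
  have hd' : -d ∈ symmPerturbations U (v x) := by
    simpa [symmPerturbations, ← sub_eq_add_neg, and_comm] using hd
  ext i
  have h1 := (hV i _ hx).2 (hzx i) d hd
  have h2 := (hV i _ hx).2 (hzx i) (-d) hd'
  rw [inner_neg_right] at h2
  have h3 : inner ℝ (EuclideanSpace.basisFun (Fin m) ℝ i) d = 0 := by linarith
  simpa [EuclideanSpace.inner_single_left] using h3

end Converse

end BangBang

theorem theorem2p5 {X : Type*} [MeasurableSpace X] (μ : Measure X) [IsFiniteMeasure μ]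
    (hμ : BangBang.Nonatomic μ) (m : ℕ) (U : Set (EuclideanSpace ℝ (Fin m)))
    (hUcompact : IsCompact U) (hUconvex : Convex ℝ U)
    (ustar : BangBang.L1 μ m) (hustar : ustar ∈ BangBang.feasibleSet μ U) :
    BangBang.IsBangBang U ustar ↔
      ∀ u : ℕ → BangBang.L1 μ m, (∀ n, u n ∈ BangBang.feasibleSet μ U) →
        BangBang.WeaklyConverges u ustar →
          Tendsto (fun n => ‖u n - ustar‖) atTop (𝓝 0) :=
  ⟨fun h _ hu hw => BangBang.tendsto_norm_sub_of_isBangBang hUcompact hUconvex h hu hw,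
    fun h => BangBang.isBangBang_of_tendsto_norm_sub hμ hUcompact hUconvex hustar h⟩
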